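/- Let $p$ be a prime and let $G$ be a finite $p$-group with $|G|\ge p^5$ and $|G:G'|\le p^3$, where $X'$ denotes the derived (commutator) subgroup of a group $X$. Then all maximal subgroups of $G$, with at most one exception, have an irreducible complex character of degree $p$. Moreover, if an exceptional maximal subgroup $H$ exists (that is, a maximal subgroup $H$ of $G$ with no irreducible complex character of degree $p$), then every maximal subgroup $M\ne H$ of $G$ satisfies $|M:M'|\le |G:G'|$. -/

import Mathlib

/-- `χ : G → ℂ` is an irreducible (complex) character of the group `G`: the character of an
irreducible representation of `G` on some finite-dimensional complex vector space, which may be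
taken to be `ℂⁿ`. Irreducible representations are nonzero. -/
def IsIrreducibleCharacter {G : Type*} [Group G] (χ : G → ℂ) : Prop :=
  ∃ (n : ℕ) (ρ : Representation ℂ G (Fin n → ℂ)), ρ.IsIrreducible ∧ ρ.character = χ

/-- The group `G` has an irreducible complex character of degree `d`, where the degree of a
character `χ` is its value `χ 1` at the identity. -/
def HasIrreducibleCharacterOfDegree (G : Type*) [Group G] (d : ℕ) : Prop :=
  ∃ χ : G → ℂ, IsIrreducibleCharacter χ ∧ χ 1 = (d : ℂ)

/-! The engine is `IsPGroup.hasIrreducibleCharacterOfDegree`: a nonabelian p-group P with |P:P'| ≤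
p^3 has a nonabelian quotient of order at most p^4 with an abelian maximal subgroup, and Clifford
theory there gives degree p.

For distinct maximal H, M and a normal N containing H' and M', G/N is a product of two abelian
maximal subgroups, so its derived subgroup has order at most p and |G:N| ≤ p|G:G'|
(`IsPGroup.index_le_of_commutators_le`). Taking N = H'M' bounds the abelianization of H/M' by p^3;
if H is exceptional, H/M' must then be abelian, so H' ≤ M'. Now N = M' gives |M:M'| ≤ |G:G'|. A
second exceptional M would therefore be abelian of order at most p^3, against |G| ≥ p^5. -/

open scoped commutatorElement

/-! ### Complex representations: irreducibility and joint eigenvectors -/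

namespace Representation

/-- A finite-dimensional representation with `c` acting nontrivially can be realised on `ℂⁿ`. -/
theorem exists_apply_ne_one_fin {P V : Type*} [Group P] [AddCommGroup V] [Module ℂ V]
    [FiniteDimensional ℂ V] {c : P} (σ : Representation ℂ P V) (hσ : σ c ≠ 1) :
    ∃ ρ : Representation ℂ P (Fin (Module.finrank ℂ V) → ℂ), ρ c ≠ 1 := by
  let e : V ≃ₗ[ℂ] (Fin (Module.finrank ℂ V) → ℂ) := (Module.finBasis ℂ V).equivFun
  refine ⟨(e.conjRingEquiv : Module.End ℂ V →* _).comp σ, fun h ↦ hσ ?_⟩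
  exact e.conjRingEquiv.injective (h.trans (map_one _).symm)

/-- A nontrivial element of a finite group acts nontrivially in some irreducible complex
representation. -/
theorem exists_isIrreducible_apply_ne_one {P : Type*} [Group P] [Finite P] {c : P} (hc : c ≠ 1) :
    ∃ (n : ℕ) (ρ : Representation ℂ P (Fin n → ℂ)), ρ.IsIrreducible ∧ ρ c ≠ 1 := by
  classical
  have : Fintype P := Fintype.ofFinite P
  have hex : ∃ (n : ℕ) (ρ : Representation ℂ P (Fin n → ℂ)), ρ c ≠ 1 := by
    -- Right regular representation: `c` moves the delta function at `c` to the one at 1.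
    obtain ⟨ρ, hρ⟩ := exists_apply_ne_one_fin (c := c) (V := P → ℂ)
      { toFun := fun g ↦ LinearMap.funLeft ℂ ℂ (fun x : P ↦ x * g)
        map_one' := by ext; simp [LinearMap.funLeft]
        map_mul' := fun x y ↦ by ext; simp [LinearMap.funLeft, mul_assoc] } (by
        intro h
        have h1 := congrFun (LinearMap.congr_fun h (Pi.single c 1)) 1
        simp [LinearMap.funLeft, Ne.symm hc] at h1)
    exact ⟨_, ρ, hρ⟩
  obtain ⟨ρ, hρ⟩ := Nat.find_spec hex
  -- `ρ` has least dimension among representations where `c` acts nontrivially, so `c` fixes every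
  -- proper subrepresentation pointwise; a Maschke decomposition would make `c` trivial.
  have hmin : ∀ W : Subrepresentation ρ, W ≠ ⊤ → ∀ w ∈ W, ρ c w = w := by
    intro W hW w hw
    by_contra hne
    obtain ⟨σ, hσ⟩ := exists_apply_ne_one_fin W.toRepresentation (fun h ↦ hne <|
      congrArg Subtype.val (LinearMap.congr_fun h ⟨w, hw⟩))
    refine Nat.find_min hex (m := Module.finrank ℂ W.toSubmodule) ?_ ⟨σ, hσ⟩
    have : W.toSubmodule ≠ ⊤ := fun h ↦ hW (Subrepresentation.toSubmodule_injective h)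
    simpa using Submodule.finrank_lt this
  refine ⟨_, ρ, ?_, hρ⟩
  have hnt : ∃ v, ρ c v ≠ v := by
    by_contra! h
    exact hρ (LinearMap.ext h)
  obtain ⟨v, hv⟩ := hnt
  have : Nontrivial (Subrepresentation ρ) := by
    refine ⟨⊥, ⊤, fun h ↦ hv ?_⟩
    have hv' : v ∈ (⊥ : Subrepresentation ρ) := h ▸ (Submodule.mem_top : v ∈ (⊤ : Submodule ℂ _))
    have : v = 0 := (Submodule.mem_bot ℂ).1 hv'
    simp [this]
  refine ⟨fun W ↦ ?_⟩
  by_contra! hW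
  have : NeZero (Nat.card P : ℂ) := ⟨by simp⟩
  obtain ⟨W', hWW'⟩ := exists_isCompl W
  have hW' : W' ≠ ⊤ := by
    rintro rfl
    exact hW.1 (by simpa using hWW'.inf_eq_bot)
  have hmem : v ∈ W.toSubmodule ⊔ W'.toSubmodule := by
    have := congrArg Subrepresentation.toSubmodule hWW'.sup_eq_top
    rw [← Subrepresentation.toSubmodule_sup, this]
    exact Submodule.mem_top
  obtain ⟨w, hw, w', hw', rfl⟩ := Submodule.mem_sup.1 hmem
  exact hv (by rw [map_add, hmin W hW.2 w hw, hmin W' hW' w' hw'])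

/-- Commuting operators of finite order on a nonzero complex vector space have a joint
eigenvector. -/
theorem exists_joint_eigenvector {A V : Type*} [Group A] [Finite A] [AddCommGroup V] [Module ℂ V]
    [FiniteDimensional ℂ V] [Nontrivial V] (ρ : Representation ℂ A V)
    (hA : ∀ a b : A, a * b = b * a) :
    ∃ (v : V) (l : A → ℂ), v ≠ 0 ∧ ∀ a, ρ a v = l a • v := by
  have htop := Module.End.iSup_iInf_maxGenEigenspace_eq_top_of_iSup_maxGenEigenspace_eq_top_of_commute
    (fun a ↦ ρ a) (fun a b _ ↦ by
      change ρ a * ρ b = ρ b * ρ a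
      rw [← map_mul, ← map_mul, hA]) (fun a ↦ Module.End.iSup_maxGenEigenspace_eq_top _)
  have : ∃ l : A → ℂ, ⨅ a, Module.End.maxGenEigenspace (ρ a) (l a) ≠ ⊥ := by
    by_contra! h
    simp [h] at htop
  obtain ⟨l, hl⟩ := this
  obtain ⟨v, hv, hv0⟩ := Submodule.exists_mem_ne_zero_of_ne_bot hl
  refine ⟨v, l, hv0, fun a ↦ ?_⟩
  -- `ρ a` is a root of the separable polynomial X^|A| - 1, so its generalized eigenspaces are
  -- eigenspaces.
  have hss : Module.End.IsSemisimple (ρ a) := by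
    refine Module.End.isSemisimple_of_squarefree_aeval_eq_zero
      (p := Polynomial.X ^ Nat.card A - 1) ?_ ?_
    · exact (Polynomial.X_pow_sub_one_separable_iff.2 (by simp [Nat.card_pos.ne'])).squarefree
    · rw [map_sub, map_one, map_pow, Polynomial.aeval_X, ← map_pow, pow_card_eq_one', map_one,
        sub_self]
  have := (Submodule.mem_iInf _).1 hv a
  rw [hss.isFinitelySemisimple.maxGenEigenspace_eq_eigenspace] at this
  exact Module.End.mem_eigenspace_iff.1 this

/-- Joint eigenvectors with distinct systems of eigenvalues are linearly independent. -/
theorem linearIndependent_of_joint_eigenvectors {A V ι : Type*} [Group A] [AddCommGroup V]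
    [Module ℂ V] (ρ : Representation ℂ A V) (hA : ∀ a b : A, a * b = b * a)
    {w : ι → V} {l : ι → A → ℂ} (hl : Function.Injective l) (hw0 : ∀ i, w i ≠ 0)
    (hw : ∀ i a, ρ a (w i) = l i a • w i) : LinearIndependent ℂ w := by
  have hind := Module.End.independent_iInf_maxGenEigenspace_of_forall_mapsTo (fun a ↦ ρ a)
    (fun a b μ ↦ Module.End.mapsTo_maxGenEigenspace_of_comm (by
      change ρ b * ρ a = ρ a * ρ b
      rw [← map_mul, ← map_mul, hA]) μ)
  refine (hind.comp hl).linearIndependent _ (fun i ↦ ?_) hw0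
  refine (Submodule.mem_iInf _).2 fun a ↦ ?_
  exact (Module.End.genEigenspace_le_maximal _ _ 1) (Module.End.mem_eigenspace_iff.2 (hw i a))

end Representation

/-! ### Clifford theory over an abelian maximal subgroup -/

open Representation in
/-- A nonabelian finite group with an abelian normal maximal subgroup of prime index `p` has an
irreducible character of degree `p`. -/
theorem hasIrreducibleCharacterOfDegree_of_abelian_index {P : Type*} [Group P] [Finite P]
    {A : Subgroup P} [A.Normal] (hcoatom : IsCoatom A) (hA : ∀ a ∈ A, ∀ b ∈ A, a * b = b * a)
    (hP : ¬ ∀ x y : P, x * y = y * x) : HasIrreducibleCharacterOfDegree P A.index := by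
  push Not at hP
  obtain ⟨x₀, y₀, hxy⟩ := hP
  obtain ⟨n, ρ, hirr, hρ⟩ := exists_isIrreducible_apply_ne_one
    (c := ⁅x₀, y₀⁆) (fun h ↦ hxy (commutatorElement_eq_one_iff_mul_comm.1 h))
  have hcomm : ρ x₀ * ρ y₀ ≠ ρ y₀ * ρ x₀ := by
    intro h
    apply hρ
    rw [commutatorElement_def, map_mul, map_mul, map_mul, h, mul_assoc (ρ y₀), ← map_mul ρ x₀,
      mul_inv_cancel, map_one, mul_one, ← map_mul, mul_inv_cancel, map_one]
  have : Nontrivial (Fin n → ℂ) := by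
    by_contra h
    rw [not_nontrivial_iff_subsingleton] at h
    exact hcomm (Subsingleton.elim _ _)
  let σ : Representation ℂ A (Fin n → ℂ) := ρ.comp A.subtype
  have hA' : ∀ a b : A, a * b = b * a := fun a b ↦ Subtype.ext (hA a a.2 b b.2)
  obtain ⟨v, l, hv0, hv⟩ := exists_joint_eigenvector σ hA'
  replace hv : ∀ a : A, ρ a v = l a • v := hv
  let conj (x : P) (a : A) : A := ⟨x⁻¹ * a * x, by
    simpa using Subgroup.Normal.conj_mem (inferInstance : A.Normal) a a.2 x⁻¹⟩
  have hconj (x : P) (a : A) : ρ a (ρ x v) = l (conj x a) • ρ x v := by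
    rw [← map_smul, ← hv, ← Module.End.mul_apply, ← Module.End.mul_apply, ← map_mul, ← map_mul]
    congr 2
    simp [conj, mul_assoc]
  have hne (x : P) : ρ x v ≠ 0 := by
    intro h
    apply hv0
    have := congrArg (ρ x⁻¹) h
    rwa [map_zero, ← Module.End.mul_apply, ← map_mul, inv_mul_cancel, map_one] at this
  -- One translate of the `A`-eigenvector per coset; another representative only rescales it. These
  -- vectors will form a basis, so the dimension is |P:A|.
  let w (q : P ⧸ A) : Fin n → ℂ := ρ q.out v
  have hspan (N : Submodule ℂ (Fin n → ℂ)) (hN : ∀ x : P, ρ x v ∈ N) : N = ⊤ := by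
    let S : Subrepresentation ρ :=
      ⟨Submodule.span ℂ (Set.range fun x : P ↦ ρ x v), fun g u hu ↦ by
        have := Submodule.mem_map_of_mem (f := ρ g) hu
        rw [Submodule.map_span] at this
        refine Submodule.span_mono ?_ this
        rintro _ ⟨_, ⟨x, rfl⟩, rfl⟩
        exact ⟨g * x, by simp⟩⟩
    have hS : S = ⊤ := by
      refine (hirr.eq_bot_or_eq_top S).resolve_left fun h ↦ hv0 ?_
      have : v ∈ S := Submodule.subset_span ⟨1, by simp⟩
      rw [h] at this
      exact (Submodule.mem_bot ℂ).1 this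
    have hS' := congrArg Subrepresentation.toSubmodule hS
    refine eq_top_iff.2 ((eq_top_iff.1 hS').trans (Submodule.span_le.2 ?_))
    rintro _ ⟨x, rfl⟩
    exact hN x
  have hwspan : Submodule.span ℂ (Set.range w) = ⊤ := by
    refine hspan _ fun x ↦ ?_
    obtain ⟨a, ha⟩ := QuotientGroup.mk_out_eq_mul A x
    have hw : w (x : P ⧸ A) = l a • ρ x v := by
      simp only [w]
      rw [ha, map_mul, Module.End.mul_apply, hv, map_smul]
    have hl : l a ≠ 0 := by
      intro h
      rw [h, zero_smul] at hw
      exact hne _ hw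
    have : ρ x v = (l a)⁻¹ • w (x : P ⧸ A) := by
      rw [hw, smul_smul, inv_mul_cancel₀ hl, one_smul]
    rw [this]
    exact Submodule.smul_mem _ _ (Submodule.subset_span ⟨_, rfl⟩)
  have hinj : Function.Injective fun (q : P ⧸ A) (a : A) ↦ l (conj q.out a) := by
    intro q r hqr
    -- A coincidence makes the stabilizer `S` of `l` strictly larger than `A`, hence all of `P`.
    -- Then `A` acts by scalars and, `A` being maximal, the image of `ρ` would be abelian.
    by_contra hne'
    let S : Subgroup P :=
      { carrier := {x | ∀ a, l (conj x a) = l a}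
        one_mem' := fun a ↦ by simp [conj]
        mul_mem' := fun {x y} hx hy a ↦ by
          rw [← hx a, ← hy (conj x a)]
          simp [conj, mul_assoc]
        inv_mem' := fun {x} hx a ↦ by
          rw [← hx (conj x⁻¹ a)]
          simp [conj, mul_assoc] }
    have hAS : A ≤ S := fun b hb a ↦ by
      congr 1
      ext
      simp only [conj]
      rw [mul_assoc, hA a a.2 b hb, inv_mul_cancel_left]
    have htS : q.out⁻¹ * r.out ∈ S := fun a ↦ by
      have := congrFun hqr (conj q.out⁻¹ a)
      simpa [conj, mul_assoc] using this.symm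
    have htA : q.out⁻¹ * r.out ∉ A := fun h ↦ hne' <| by
      rw [← QuotientGroup.out_eq' q, ← QuotientGroup.out_eq' r]
      exact QuotientGroup.eq.2 h
    have hS : S = ⊤ := hcoatom.2 _ (lt_of_le_of_ne hAS fun h ↦ htA (h.ge htS))
    have hscal (a : A) : ρ a = l a • 1 := by
      have := hspan (LinearMap.ker (ρ a - l a • (1 : Module.End ℂ (Fin n → ℂ)))) fun x ↦ by
        have hx : x ∈ S := hS ▸ Subgroup.mem_top x
        rw [LinearMap.mem_ker, LinearMap.sub_apply, hconj, hx a]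
        simp
      exact sub_eq_zero.1 (LinearMap.ker_eq_top.1 this)
    have hcent (y : P) (a : A) : ρ a * ρ y = ρ y * ρ a := by simp [hscal]
    by_cases hy : y₀ ∈ A
    · exact hcomm (hcent x₀ ⟨y₀, hy⟩).symm
    · let f := ρ.toHomUnits
      let C : Subgroup P := (Subgroup.centralizer {f y₀}).comap f
      have hC (x : P) : x ∈ C ↔ ρ y₀ * ρ x = ρ x * ρ y₀ := by
        rw [Subgroup.mem_comap, Subgroup.mem_centralizer_singleton_iff, Units.ext_iff]
        exact eq_comm
      have hCtop : C = ⊤ := hcoatom.2 _ (lt_of_le_of_ne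
        (fun a ha ↦ (hC a).2 (hcent y₀ ⟨a, ha⟩).symm) fun h ↦ hy (h.ge ((hC y₀).2 rfl)))
      exact hcomm ((hC x₀).1 (hCtop ▸ Subgroup.mem_top x₀)).symm
  have hlin : LinearIndependent ℂ w := linearIndependent_of_joint_eigenvectors σ hA' hinj
    (fun q ↦ hne _) (fun q a ↦ hconj _ a)
  have hdim := Module.finrank_eq_nat_card_basis (Module.Basis.mk hlin hwspan.ge)
  refine ⟨ρ.character, ⟨n, ρ, hirr, rfl⟩, ?_⟩
  rw [char_one, hdim]
  rfl

/-! ### Inflation of characters and derived subgroups of quotients -/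

theorem HasIrreducibleCharacterOfDegree.of_surjective {G Q : Type*} [Group G] [Group Q]
    (f : G →* Q) (hf : Function.Surjective f) {d : ℕ} (h : HasIrreducibleCharacterOfDegree Q d) :
    HasIrreducibleCharacterOfDegree G d := by
  obtain ⟨_, ⟨n, ρ, hρ, rfl⟩, hd⟩ := h
  let σ : Representation ℂ G (Fin n → ℂ) := ρ.comp f
  refine ⟨σ.character, ⟨n, σ, ?_, rfl⟩, by rw [← hd, Representation.char_one,
    Representation.char_one]⟩
  let e : Subrepresentation σ ≃o Subrepresentation ρ :=
    { toFun := fun W ↦ ⟨W.toSubmodule, fun q v hv ↦ by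
        obtain ⟨g, rfl⟩ := hf q
        exact W.apply_mem_toSubmodule g hv⟩
      invFun := fun W ↦ ⟨W.toSubmodule, fun g v hv ↦ W.apply_mem_toSubmodule (f g) hv⟩
      left_inv := fun _ ↦ rfl
      right_inv := fun _ ↦ rfl
      map_rel_iff' := Iff.rfl }
  exact e.isSimpleOrder_iff.2 hρ

theorem commutator_map_of_surjective {G Q : Type*} [Group G] [Group Q] (f : G →* Q)
    (hf : Function.Surjective f) : (commutator G).map f = commutator Q := by
  rw [map_commutator_eq _ f, MonoidHom.range_eq_top.2 hf, ← commutator_def]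

theorem index_commutator_le_of_surjective {G Q : Type*} [Group G] [Finite G] [Group Q]
    (f : G →* Q) (hf : Function.Surjective f) :
    (commutator Q).index ≤ (commutator G).index := by
  rw [← commutator_map_of_surjective f hf]
  exact Nat.le_of_dvd (Nat.pos_of_ne_zero Subgroup.FiniteIndex.index_ne_zero)
    (Subgroup.index_map_dvd _ hf)

theorem Subgroup.isCoatom_of_index_prime {p : ℕ} [Fact p.Prime] {G : Type*} [Group G]
    {H : Subgroup G} (hH : H.index = p) : IsCoatom H := by
  have hp : p.Prime := Fact.out
  refine ⟨fun h ↦ hp.one_lt.ne' (by rw [← hH, h, Subgroup.index_top]), fun K hK ↦ ?_⟩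
  have h := Subgroup.relIndex_mul_index hK.le
  rw [hH] at h
  rcases (Nat.dvd_prime hp).1 (Dvd.intro_left _ h) with h1 | h1
  · exact Subgroup.index_eq_one.1 h1
  · rw [h1] at h
    have : H.relIndex K = 1 := Nat.eq_of_mul_eq_mul_right hp.pos (by rw [h, one_mul])
    exact absurd (Subgroup.relIndex_eq_one.1 this) (not_le_of_gt hK)

/-! ### Finite p-groups with small abelianization -/

section PGroup

variable {p : ℕ} [Fact p.Prime] {G : Type*} [Group G] [Finite G]

theorem IsPGroup.normal_of_isCoatom (hG : IsPGroup p G) {H : Subgroup G} (hH : IsCoatom H) :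
    H.Normal := by
  have := hG.isNilpotent
  exact Subgroup.NormalizerCondition.normal_of_coatom H Group.normalizerCondition_of_isNilpotent hH

/-- By Sylow, a proper subgroup of order p^n lies in one of order p^(n+1), which by maximality is
the whole group. -/
theorem IsPGroup.index_eq_of_isCoatom (hG : IsPGroup p G) {H : Subgroup G} (hH : IsCoatom H) :
    H.index = p := by
  have hp : p.Prime := Fact.out
  obtain ⟨n, hn⟩ := IsPGroup.iff_card.1 (hG.to_subgroup H)
  obtain ⟨m, hm⟩ := hG.index H
  have hm0 : m ≠ 0 := by
    rintro rfl
    exact hH.1 (Subgroup.index_eq_one.1 (by simpa using hm))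
  have hcard : Nat.card G = p ^ (n + m) := by
    rw [← H.card_mul_index, hn, hm, pow_add]
  obtain ⟨K, hK, hHK⟩ := Sylow.exists_subgroup_card_pow_prime_le p (m := n + 1)
    (hcard ▸ pow_dvd_pow p (by omega)) H hn (by omega)
  have hne : H ≠ K := by
    rintro rfl
    exact absurd (Nat.pow_right_injective hp.two_le (hn.symm.trans hK)) (by omega)
  have hKtop := hH.2 K (lt_of_le_of_ne hHK hne)
  rw [hKtop, Subgroup.card_top, hcard] at hK
  have := Nat.pow_right_injective hp.two_le hK
  rw [hm, show m = 1 by omega, pow_one]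

/-- A nonabelian group of order at most `p ^ 4` with central derived subgroup of order `p` has an
abelian normal subgroup of index `p`. -/
theorem IsPGroup.exists_abelian_normal_index (hG : IsPGroup p G) (hcard : Nat.card G ≤ p ^ 4)
    (hcomm : Nat.card (commutator G) = p) (hcent : commutator G ≤ Subgroup.center G) :
    ∃ A : Subgroup G, A.Normal ∧ A.index = p ∧ ∀ a ∈ A, ∀ b ∈ A, a * b = b * a := by
  have hp : p.Prime := Fact.out
  have hmem (x y : G) : ⁅x, y⁆ ∈ commutator G :=
    Subgroup.commutator_mem_commutator (Subgroup.mem_top x) (Subgroup.mem_top y)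
  have hcne : Subgroup.center G ≠ ⊤ := by
    rw [Ne, ← commutator_eq_bot_iff_center_eq_top]
    intro h
    rw [h, Subgroup.card_bot] at hcomm
    exact hp.one_lt.ne hcomm
  obtain ⟨x, hx⟩ : ∃ x, x ∉ Subgroup.center G := by
    by_contra! h
    exact hcne (eq_top_iff.2 fun x _ ↦ h x)
  have hmul (y z : G) : ⁅x, y * z⁆ = ⁅x, y⁆ * ⁅x, z⁆ := by
    have h := Subgroup.mem_center_iff.1 (hcent (hmem x z)) y
    calc ⁅x, y * z⁆ = ⁅x, y⁆ * (y * ⁅x, z⁆ * y⁻¹) := by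
          simp only [commutatorElement_def]; group
      _ = _ := by rw [h, mul_inv_cancel_right]
  -- The abelian subgroup is the centralizer of the noncentral `x`, the kernel of this map; its
  -- index divides |G'| = p.
  let f : G →* commutator G :=
    { toFun := fun y ↦ ⟨⁅x, y⁆, hmem x y⟩
      map_one' := by simp
      map_mul' := fun y z ↦ Subtype.ext (hmul y z) }
  have hker (y : G) : y ∈ f.ker ↔ x * y = y * x := by
    rw [MonoidHom.mem_ker, ← commutatorElement_eq_one_iff_mul_comm, Subtype.ext_iff]
    rfl
  have hindex : f.ker.index = p := by
    have hdvd : f.ker.index ∣ p := by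
      rw [Subgroup.index_ker, ← hcomm]
      exact Subgroup.card_subgroup_dvd_card _
    refine ((Nat.dvd_prime hp).1 hdvd).resolve_left fun h ↦ hx ?_
    rw [Subgroup.index_eq_one] at h
    exact Subgroup.mem_center_iff.2 fun y ↦ ((hker y).1 (h ▸ Subgroup.mem_top y)).symm
  refine ⟨f.ker, inferInstance, hindex, ?_⟩
  have hcA : Nat.card f.ker ≤ p ^ 3 := by
    have := f.ker.card_mul_index
    rw [hindex] at this
    refine Nat.le_of_mul_le_mul_right ?_ hp.pos
    rw [this, ← pow_succ]
    exact hcard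
  have hxA : x ∈ f.ker := (hker x).2 rfl
  have hzA : Subgroup.center G ≤ f.ker := fun z hz ↦ (hker z).2 (Subgroup.mem_center_iff.1 hz x)
  -- The centre of the centralizer also contains `x`, so its order exceeds p and is at least p^2.
  -- The centralizer has order at most p^3, so it is cyclic modulo its centre, hence abelian.
  have hlt : Subgroup.center G < (Subgroup.center f.ker).map f.ker.subtype := by
    refine lt_of_le_of_ne (fun z hz ↦ ⟨⟨z, hzA hz⟩, ?_, rfl⟩) fun h ↦ hx ?_
    · exact Subgroup.mem_center_iff.2 fun g ↦ Subtype.ext (Subgroup.mem_center_iff.1 hz g)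
    · rw [h]
      exact ⟨⟨x, hxA⟩, Subgroup.mem_center_iff.2 fun g ↦ Subtype.ext ((hker g).1 g.2).symm, rfl⟩
  have hcard_lt : p < Nat.card (Subgroup.center f.ker) := by
    rw [← Subgroup.card_map_of_injective f.ker.subtype_injective]
    calc p ≤ Nat.card (Subgroup.center G) := hcomm ▸ Subgroup.card_le_of_le hcent
      _ < _ := Set.ncard_lt_ncard hlt
  have hPA : IsPGroup p f.ker := hG.to_subgroup _
  obtain ⟨k, hk⟩ := IsPGroup.iff_card.1 (hPA.to_subgroup (Subgroup.center f.ker))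
  obtain ⟨m, hm⟩ := hPA.index (Subgroup.center f.ker)
  have hk2 : 2 ≤ k := by
    rw [hk] at hcard_lt
    exact (Nat.pow_lt_pow_iff_right hp.one_lt).1 (by simpa using hcard_lt)
  have hm1 : m ≤ 1 := by
    have := (Subgroup.center f.ker).card_mul_index
    rw [hk, hm, ← pow_add] at this
    rw [← this, Nat.pow_le_pow_iff_right hp.one_lt] at hcA
    omega
  have : IsCyclic (f.ker ⧸ Subgroup.center f.ker) :=
    isCyclic_of_card_dvd_prime (p := p) (by
      change (Subgroup.center f.ker).index ∣ p
      rw [hm]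
      simpa using pow_dvd_pow p hm1)
  have := isMulCommutative_of_isCyclic_quotient_center_self f.ker
  exact fun a ha b hb ↦ congrArg Subtype.val (this.is_comm.comm (⟨a, ha⟩ : f.ker) ⟨b, hb⟩)

end PGroup

/-- A nonabelian finite `p`-group whose abelianization has order at most `p ^ 3` has an irreducible
character of degree `p`. -/
theorem IsPGroup.hasIrreducibleCharacterOfDegree {p : ℕ} [Fact p.Prime] {G : Type*} [Group G]
    [Finite G] (hG : IsPGroup p G) (hnc : commutator G ≠ ⊥) (hindex : (commutator G).index ≤ p ^ 3) :
    HasIrreducibleCharacterOfDegree G p := by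
  have hp : p.Prime := Fact.out
  induction h : Nat.card G using Nat.strong_induction_on generalizing G with
  | _ n ih =>
  -- Either a proper quotient is still nonabelian and induction applies, or every nontrivial normal
  -- subgroup contains G'. In the latter case a central subgroup of order p forces |G'| = p and |G|
  -- ≤ p^4.
  by_cases hN : ∃ N : Subgroup G, N.Normal ∧ N ≠ ⊥ ∧ ¬ commutator G ≤ N
  · obtain ⟨N, _, hN, hle⟩ := hN
    have hlt : Nat.card (G ⧸ N) < n := by
      have := N.card_mul_index
      have h1 : 1 < Nat.card N := by
        rwa [Subgroup.one_lt_card_iff_ne_bot]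
      rw [← h, ← this]
      exact lt_mul_of_one_lt_left (Nat.card_pos (α := G ⧸ N)) h1
    refine .of_surjective (QuotientGroup.mk' N) (QuotientGroup.mk'_surjective N)
      (ih _ hlt (hG.to_quotient N) (fun hbot ↦ hle ?_)
        ((index_commutator_le_of_surjective _ (QuotientGroup.mk'_surjective N)).trans hindex) rfl)
    rw [← commutator_map_of_surjective _ (QuotientGroup.mk'_surjective N), Subgroup.map_eq_bot_iff,
      QuotientGroup.ker_mk'] at hbot
    exact hbot
  · push Not at hN
    have : Nontrivial G := by
      by_contra hs
      rw [not_nontrivial_iff_subsingleton] at hs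
      exact hnc (Subsingleton.elim _ _)
    have := hG.center_nontrivial
    have hdvd : p ∣ Nat.card (Subgroup.center G) :=
      ((hG.to_subgroup _).card_eq_or_dvd).resolve_left Finite.one_lt_card.ne'
    obtain ⟨z, hz⟩ := exists_prime_orderOf_dvd_card' p hdvd
    have hz' : orderOf (z : G) = p := by rw [Subgroup.orderOf_coe, hz]
    have hzc : Subgroup.zpowers (z : G) ≤ Subgroup.center G := by
      rw [Subgroup.zpowers_le]
      exact z.2
    have hzn : (Subgroup.zpowers (z : G)).Normal := ⟨fun a ha g ↦ by
      rwa [Subgroup.mem_center_iff.1 (hzc ha) g, mul_inv_cancel_right]⟩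
    have hle := hN _ hzn (fun hb ↦ by
      rw [← Nat.card_zpowers, hb, Subgroup.card_bot] at hz'
      exact hp.one_lt.ne hz')
    have hcomm : Nat.card (commutator G) = p := by
      have hd := Subgroup.card_dvd_of_le hle
      rw [Nat.card_zpowers, hz'] at hd
      refine ((Nat.dvd_prime hp).1 hd).resolve_left fun h1 ↦ hnc ?_
      exact Subgroup.card_eq_one.1 h1
    have hcard : Nat.card G ≤ p ^ 4 := by
      rw [← (commutator G).card_mul_index, hcomm, pow_succ' p 3]
      exact Nat.mul_le_mul_left _ hindex
    obtain ⟨A, hAn, hAi, hA⟩ := hG.exists_abelian_normal_index hcard hcomm (hle.trans hzc)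
    rw [← hAi]
    refine hasIrreducibleCharacterOfDegree_of_abelian_index (Subgroup.isCoatom_of_index_prime hAi) hA
      fun hab ↦ hnc ?_
    rw [commutator_def, eq_bot_iff, Subgroup.commutator_le]
    exact fun x _ y _ ↦ commutatorElement_eq_one_iff_mul_comm.2 (hab x y)

/-! ### Derived subgroups of groups generated by abelian subgroups -/

/-- If a finite group is generated by an abelian normal subgroup `A` and an element `b` of an
abelian subgroup `B`, then its derived subgroup has order at most the index of `B`. -/
theorem card_commutator_le_index {G : Type*} [Group G] [Finite G] {A B : Subgroup G} [A.Normal]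
    (hA : ∀ x ∈ A, ∀ y ∈ A, x * y = y * x) (hB : ∀ x ∈ B, ∀ y ∈ B, x * y = y * x) {b : G}
    (hb : b ∈ B) (htop : A ⊔ Subgroup.zpowers b = ⊤) :
    Nat.card (commutator G) ≤ B.index := by
  have hAn : A.Normal := inferInstance
  have top_of {K : Subgroup G} (hAK : A ≤ K) (hbK : b ∈ K) (x : G) : x ∈ K := by
    have : (⊤ : Subgroup G) ≤ K := htop ▸ sup_le hAK (Subgroup.zpowers_le.2 hbK)
    exact this (Subgroup.mem_top x)
  -- The range turns out normal, and modulo it `b` commutes with `A`, so it contains G'. The kernel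
  -- contains A ∩ B, whence the bound.
  let f : A →* G :=
    { toFun := fun a ↦ ⁅(a : G), b⁆
      map_one' := by simp
      map_mul' := fun x y ↦ by
        have hy : b * (y : G)⁻¹ * b⁻¹ ∈ A := hAn.conj_mem _ (inv_mem y.2) b
        have hx : b * (x : G)⁻¹ * b⁻¹ ∈ A := hAn.conj_mem _ (inv_mem x.2) b
        have h := hA _ hx _ (mul_mem y.2 hy)
        calc ⁅((x * y : A) : G), b⁆
            = x * ((y * (b * (y : G)⁻¹ * b⁻¹)) * (b * (x : G)⁻¹ * b⁻¹)) := by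
              simp only [commutatorElement_def, Subgroup.coe_mul]; group
          _ = x * ((b * (x : G)⁻¹ * b⁻¹) * (y * (b * (y : G)⁻¹ * b⁻¹))) := by rw [h]
          _ = ⁅(x : G), b⁆ * ⁅(y : G), b⁆ := by
              simp only [commutatorElement_def]; group }
  have hf (a : A) : f a = ⁅(a : G), b⁆ := rfl
  have hRA : f.range ≤ A := by
    rintro _ ⟨a, rfl⟩
    rw [hf, commutatorElement_def, mul_assoc, mul_assoc, ← mul_assoc b]
    exact mul_mem a.2 (hAn.conj_mem _ (inv_mem a.2) b)
  have hRn : f.range.Normal := by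
    rw [← Subgroup.normalizer_eq_top_iff, eq_top_iff]
    refine fun x _ ↦ top_of (fun x hx ↦ ?_) ?_ x
    · refine Subgroup.mem_normalizer_iff.2 fun h ↦ ?_
      have key (h : G) (hh : h ∈ A) : x * h * x⁻¹ = h := by
        rw [hA x hx h hh, mul_inv_cancel_right]
      refine ⟨fun hh ↦ by rwa [key h (hRA hh)], fun hh ↦ ?_⟩
      have : h ∈ A := by
        have := hAn.conj_mem _ (hRA hh) x⁻¹
        simpa [mul_assoc] using this
      rwa [key h this] at hh
    · refine Subgroup.mem_normalizer_iff.2 fun h ↦ ⟨?_, ?_⟩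
      · rintro ⟨a, rfl⟩
        refine ⟨⟨b * a * b⁻¹, hAn.conj_mem _ a.2 b⟩, ?_⟩
        simp only [hf, commutatorElement_def]; group
      · rintro ⟨a, ha⟩
        refine ⟨⟨b⁻¹ * a * b, by simpa using hAn.conj_mem _ a.2 b⁻¹⟩, ?_⟩
        rw [hf] at ha ⊢
        have : h = b⁻¹ * ⁅(a : G), b⁆ * b := by rw [ha]; group
        rw [this]
        simp only [commutatorElement_def]; group
  let π := QuotientGroup.mk' f.range
  have hπ (a : G) (ha : a ∈ A) : π b * π a = π a * π b := by
    have : π ⁅a, b⁆ = 1 := (QuotientGroup.eq_one_iff _).2 ⟨⟨a, ha⟩, rfl⟩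
    rw [map_commutatorElement] at this
    exact (commutatorElement_eq_one_iff_mul_comm.1 this).symm
  have hπA (a : G) (ha : a ∈ A) (x : G) : π x * π a = π a * π x := by
    have : x ∈ (Subgroup.centralizer {π a}).comap π := by
      refine top_of (fun y hy ↦ ?_) ?_ x
      · rw [Subgroup.mem_comap, Subgroup.mem_centralizer_singleton_iff, ← map_mul, ← map_mul,
          hA y hy a ha]
      · rw [Subgroup.mem_comap, Subgroup.mem_centralizer_singleton_iff]
        exact hπ a ha
    rwa [Subgroup.mem_comap, Subgroup.mem_centralizer_singleton_iff] at this
  have hπc (x y : G) : π x * π y = π y * π x := by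
    have : y ∈ (Subgroup.centralizer {π x}).comap π := by
      refine top_of (fun y hy ↦ ?_) ?_ y
      · rw [Subgroup.mem_comap, Subgroup.mem_centralizer_singleton_iff]
        exact (hπA y hy x).symm
      · have : x ∈ (Subgroup.centralizer {π b}).comap π := by
          refine top_of (fun y hy ↦ ?_) ?_ x
          · rw [Subgroup.mem_comap, Subgroup.mem_centralizer_singleton_iff]
            exact (hπ y hy).symm
          · rw [Subgroup.mem_comap, Subgroup.mem_centralizer_singleton_iff]
        rw [Subgroup.mem_comap, Subgroup.mem_centralizer_singleton_iff] at this ⊢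
        exact this.symm
    rw [Subgroup.mem_comap, Subgroup.mem_centralizer_singleton_iff] at this
    exact this.symm
  have hle : commutator G ≤ f.range := by
    rw [commutator_def, Subgroup.commutator_le]
    intro x _ y _
    rw [← QuotientGroup.eq_one_iff]
    change π ⁅x, y⁆ = 1
    rw [map_commutatorElement]
    exact commutatorElement_eq_one_iff_mul_comm.2 (hπc x y)
  calc Nat.card (commutator G) ≤ Nat.card f.range := Subgroup.card_le_of_le hle
    _ = f.ker.index := (Subgroup.index_ker f).symm
    _ ≤ (B.subgroupOf A).index := Subgroup.index_antitone (fun a ha ↦ by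
        rw [MonoidHom.mem_ker, hf, commutatorElement_eq_one_iff_mul_comm]
        exact hB _ ha _ hb)
    _ ≤ B.index := by
        rw [← Subgroup.relIndex_top_right B]
        exact Subgroup.relIndex_le_of_le_right le_top (by
          rw [Subgroup.relIndex_top_right]
          exact Subgroup.FiniteIndex.index_ne_zero)

theorem Subgroup.index_commutator_self {G : Type*} [Group G] (H : Subgroup G) :
    ⁅H, H⁆.index = (_root_.commutator H).index * H.index := by
  rw [← H.map_subtype_commutator, Subgroup.index_map_subtype]

/-! ### Comparing derived subgroups of maximal subgroups -/

section MaximalSubgroups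

variable {p : ℕ} [Fact p.Prime] {G : Type*} [Group G] [Finite G]

/-- In a finite `p`-group, a normal subgroup containing the derived subgroups of two distinct
maximal subgroups has index at most `p` times the order of the abelianization. -/
theorem IsPGroup.index_le_of_commutators_le (hG : IsPGroup p G) {H M N : Subgroup G} [N.Normal]
    (hH : IsCoatom H) (hM : IsCoatom M) (hne : M ≠ H) (hHN : ⁅H, H⁆ ≤ N) (hMN : ⁅M, M⁆ ≤ N) :
    N.index ≤ p * (commutator G).index := by
  let π := QuotientGroup.mk' N
  have hπ : Function.Surjective π := QuotientGroup.mk'_surjective N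
  obtain ⟨b, hbM, hbH⟩ : ∃ b ∈ M, b ∉ H := by
    by_contra! h
    exact hH.1 (hM.2 H (lt_of_le_of_ne h hne))
  have := hG.normal_of_isCoatom hH
  have : (H.map π).Normal := Subgroup.Normal.map this π hπ
  have abelian {K : Subgroup G} (hK : ⁅K, K⁆ ≤ N) : ∀ x ∈ K.map π, ∀ y ∈ K.map π,
      x * y = y * x := by
    rintro _ ⟨x, hx, rfl⟩ _ ⟨y, hy, rfl⟩
    rw [← commutatorElement_eq_one_iff_mul_comm, ← map_commutatorElement]
    exact (QuotientGroup.eq_one_iff _).2 (hK (Subgroup.commutator_mem_commutator hx hy))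
  have htop : H.map π ⊔ Subgroup.zpowers (π b) = ⊤ := by
    have : H ⊔ Subgroup.zpowers b = ⊤ := hH.2 _ (lt_of_le_of_ne le_sup_left fun h ↦
      hbH (h.ge (Subgroup.mem_sup_right (Subgroup.mem_zpowers b))))
    rw [← MonoidHom.map_zpowers, ← Subgroup.map_sup, this, Subgroup.map_top_of_surjective π hπ]
  have hcard := card_commutator_le_index (abelian hHN) (abelian hMN)
    (Subgroup.mem_map_of_mem π hbM) htop
  have hMi : (M.map π).index ≤ p := by
    rw [← hG.index_eq_of_isCoatom hM]
    exact Nat.le_of_dvd (Nat.pos_of_ne_zero Subgroup.FiniteIndex.index_ne_zero)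
      (Subgroup.index_map_dvd _ hπ)
  calc N.index = Nat.card (commutator (G ⧸ N)) * (commutator (G ⧸ N)).index :=
        (Subgroup.card_mul_index _).symm
    _ ≤ p * (commutator G).index :=
        Nat.mul_le_mul (hcard.trans hMi) (index_commutator_le_of_surjective π hπ)

theorem IsPGroup.commutator_le_of_isCoatom (hG : IsPGroup p G) {H : Subgroup G}
    (hH : IsCoatom H) : commutator G ≤ H := by
  have := hG.normal_of_isCoatom hH
  have : IsCyclic (G ⧸ H) := isCyclic_of_prime_card (p := p) (hG.index_eq_of_isCoatom hH)
  exact Subgroup.Normal.quotient_commutative_iff_commutator_le.1 inferInstance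

/-- A maximal subgroup without irreducible characters of degree `p` has its derived subgroup
contained in those of all other maximal subgroups. -/
theorem IsPGroup.commutator_le_commutator_of_exceptional (hG : IsPGroup p G)
    (hindex : (commutator G).index ≤ p ^ 3) {H M : Subgroup G} (hH : IsCoatom H)
    (hM : IsCoatom M) (hne : M ≠ H) (hex : ¬ HasIrreducibleCharacterOfDegree H p) :
    ⁅H, H⁆ ≤ ⁅M, M⁆ := by
  have hp : p.Prime := Fact.out
  by_contra hle
  have := hG.normal_of_isCoatom hH
  have := hG.normal_of_isCoatom hM
  have hMH : ⁅M, M⁆ ≤ H :=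
    (Subgroup.commutator_mono le_top le_top).trans (hG.commutator_le_of_isCoatom hH)
  -- If H' is not inside M', this quotient H/M' is nonabelian; its abelianization is H/H'M', of
  -- order at most |G:G'|.
  let π := QuotientGroup.mk' (⁅M, M⁆.subgroupOf H)
  have hπ : Function.Surjective π := QuotientGroup.mk'_surjective _
  have hmap : (commutator H).map π = commutator (H ⧸ ⁅M, M⁆.subgroupOf H) :=
    commutator_map_of_surjective π hπ
  have hN : (commutator H ⊔ ⁅M, M⁆.subgroupOf H).map H.subtype = ⁅H, H⁆ ⊔ ⁅M, M⁆ := by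
    rw [Subgroup.map_sup, H.map_subtype_commutator, Subgroup.map_subgroupOf_eq_of_le hMH]
  refine hex (.of_surjective π hπ (IsPGroup.hasIrreducibleCharacterOfDegree
    ((hG.to_subgroup H).to_quotient _) (fun hbot ↦ hle ?_) ?_))
  · rw [← hmap, Subgroup.map_eq_bot_iff, QuotientGroup.ker_mk'] at hbot
    rw [← H.map_subtype_commutator, ← Subgroup.map_subgroupOf_eq_of_le hMH]
    exact Subgroup.map_mono hbot
  · have h := hG.index_le_of_commutators_le hH hM hne (N := ⁅H, H⁆ ⊔ ⁅M, M⁆) le_sup_left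
      le_sup_right
    rw [← hN, Subgroup.index_map_subtype, hG.index_eq_of_isCoatom hH, mul_comm] at h
    rw [← hmap, Subgroup.index_map, MonoidHom.range_eq_top.2 hπ, Subgroup.index_top, mul_one,
      QuotientGroup.ker_mk']
    exact (Nat.le_of_mul_le_mul_left h hp.pos).trans hindex

end MaximalSubgroups

theorem proposition6 (p : ℕ) [Fact p.Prime] (G : Type*) [Group G] [Finite G]
    (hG : IsPGroup p G) (hcard : p ^ 5 ≤ Nat.card G) (hindex : (commutator G).index ≤ p ^ 3) :
    (∀ H K : Subgroup G, IsCoatom H → IsCoatom K →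
      ¬ HasIrreducibleCharacterOfDegree H p → ¬ HasIrreducibleCharacterOfDegree K p → H = K) ∧
    (∀ H : Subgroup G, IsCoatom H → ¬ HasIrreducibleCharacterOfDegree H p →
      ∀ M : Subgroup G, IsCoatom M → M ≠ H →
        (commutator M).index ≤ (commutator G).index) := by
  have hp : p.Prime := Fact.out
  have bound {H M : Subgroup G} (hH : IsCoatom H) (hex : ¬ HasIrreducibleCharacterOfDegree H p)
      (hM : IsCoatom M) (hne : M ≠ H) : (commutator M).index ≤ (commutator G).index := by
    have := hG.normal_of_isCoatom hM
    have h := hG.index_le_of_commutators_le hH hM hne (N := ⁅M, M⁆)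
      (hG.commutator_le_commutator_of_exceptional hindex hH hM hne hex) le_rfl
    rw [Subgroup.index_commutator_self, hG.index_eq_of_isCoatom hM, mul_comm] at h
    exact Nat.le_of_mul_le_mul_left h hp.pos
  refine ⟨fun H K hH hK hexH hexK ↦ ?_, fun H hH hex M hM hne ↦ bound hH hex hM hne⟩
  by_contra hne
  have hKi := (bound hH hexH hK (Ne.symm hne)).trans hindex
  -- An abelian `K` would have order at most p^3, giving |G| ≤ p^4.
  by_cases hab : commutator K = ⊥
  · rw [hab, Subgroup.index_bot] at hKi
    have h := K.card_mul_index
    rw [hG.index_eq_of_isCoatom hK] at h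
    have h1 : Nat.card G ≤ p ^ 4 := by
      rw [← h, pow_succ]
      exact Nat.mul_le_mul_right _ hKi
    have h2 : p ^ 4 < p ^ 5 := Nat.pow_lt_pow_right hp.one_lt (by norm_num)
    omega
  · exact hexK ((hG.to_subgroup K).hasIrreducibleCharacterOfDegree hab hKi)
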